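/- Let $\mathscr M$ be a von Neumann algebra acting on a complex Hilbert space $\mathcal H$. For bounded operators $A, B$ on $\mathcal H$ with $\mathrm{null}(B) \subseteq \mathrm{null}(A)$, let $A/B$ denote the (possibly unbounded) linear operator on $\mathcal H$ with domain $\mathrm{ran}(B)$ given by $Bx \mapsto Ax$ ($x \in \mathcal H$). Theorem (Uniqueness of quotient representation). For $i = 1, 2$ let $A_i, B_i \in \mathscr M$ with $\mathrm{null}(B_i) \subseteq \mathrm{null}(A_i)$. Then $A_1/B_1 = A_2/B_2$ (equality of domains and of values) if and only if there are an element $C \in \mathscr M$ that is right-invertible in $\mathscr M$ (that is, $CD = I$ for some $D \in \mathscr M$) and orthogonal projections $P, Q$ in the centre of $\mathscr M$ with $P + Q = I$ such that $$A_1 P = A_2 C P, \quad B_1 P = B_2 C P, \quad A_2 Q = A_1 C Q, \quad B_2 Q = B_1 C Q.$$ -/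

import Mathlib

section QuotientOperator

variable {H : Type*} [NormedAddCommGroup H] [InnerProductSpace ℂ H]

/-- The quotient `A/B` of two bounded operators with `null B ⊆ null A`: the (possibly unbounded)
linear operator on `H` with domain `ran B` that sends `B x` to `A x`. It is built as the map
`H / null B → H` induced by `A`, composed with the inverse of the isomorphism
`H / null B ≃ ran B` induced by `B`. -/
noncomputable def quotientOperator (A B : H →L[ℂ] H)
    (h : LinearMap.ker B.toLinearMap ≤ LinearMap.ker A.toLinearMap) : H →ₗ.[ℂ] H where
  domain := LinearMap.range B.toLinearMap
  toFun := (LinearMap.ker B.toLinearMap).liftQ A.toLinearMap h ∘ₗ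
    B.toLinearMap.quotKerEquivRange.symm.toLinearMap

theorem quotientOperator_domain (A B : H →L[ℂ] H)
    (h : LinearMap.ker B.toLinearMap ≤ LinearMap.ker A.toLinearMap) :
    (quotientOperator A B h).domain = LinearMap.range B.toLinearMap := rfl

theorem quotientOperator_apply (A B : H →L[ℂ] H)
    (h : LinearMap.ker B.toLinearMap ≤ LinearMap.ker A.toLinearMap) (x : H) :
    quotientOperator A B h ⟨B x, x, rfl⟩ = A x := by
  have e : B.toLinearMap.quotKerEquivRange.symm ⟨B x, x, rfl⟩ =
      (LinearMap.ker B.toLinearMap).mkQ x := by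
    rw [LinearEquiv.symm_apply_eq]
    rfl
  change (LinearMap.ker B.toLinearMap).liftQ A.toLinearMap h
    (B.toLinearMap.quotKerEquivRange.symm ⟨B x, x, rfl⟩) = A x
  rw [e]
  rfl

/-- `A/B` is the only linear operator `T` with domain `ran B` such that `T B = A`. -/
theorem eq_quotientOperator (A B : H →L[ℂ] H)
    (h : LinearMap.ker B.toLinearMap ≤ LinearMap.ker A.toLinearMap) (T : H →ₗ.[ℂ] H)
    (hdom : T.domain = LinearMap.range B.toLinearMap)
    (hT : ∀ (x : H) (hx : B x ∈ T.domain), T ⟨B x, hx⟩ = A x) :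
    T = quotientOperator A B h := by
  refine LinearPMap.ext hdom ?_
  rintro y hy ⟨x, rfl⟩
  exact (hT x hy).trans (quotientOperator_apply A B h x).symm

end QuotientOperator

/-!
If `A₁/B₁ = A₂/B₂`, then `ran B₁ = ran B₂`. Let `Eᵢ` be the projection onto `null Bᵢ`. Douglas
factorization inside `M` (`VonNeumannAlgebra.exists_eq_mul_of_range_le`) gives `X, Y ∈ M` with
`B₁ = B₂ X` and `B₂ = B₁ Y`, inverse to each other between `(null B₁)ᗮ` and `(null B₂)ᗮ` and zero
on the null spaces. Equality of values means `A₁ = A₂ X` and `A₂ = A₁ Y`. None of these equations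
changes when `X` and `Y` are modified by operators between the null spaces, so right-invertibility
can be arranged there: the comparison theorem (`VonNeumannAlgebra.exists_comparison`) supplies a
partial isometry `V ∈ M` from `null B₁` to `null B₂` and a central projection `P` such that `V V*`
is all of `E₂` under `P` and `V* V` is all of `E₁` under `Q = 1 - P`. Then
`C = (X + V) P + (Y + V*) Q` has the right inverse `(Y + V*) P + (X + V) Q`.

The comparison theorem is obtained from a maximal isometric subspace of `ran E₁ × ran E₂` that is
invariant under the commutant: subspaces are convenient for Zorn's lemma because chains are bounded
by their unions. A maximal one is closed, hence comes from a partial isometry `V ∈ M`. Maximality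
and polar decomposition give `(E₂ - V V*) M (E₁ - V* V) = 0`
(`IsIsometricCoupling.mul_mul_eq_zero_of_maximal`), so that the central support of `E₁ - V* V` is a
central projection separating the two defects.

Operators are shown to lie in `M` by exhibiting their graphs as closed subspaces invariant under
the commutant (`VonNeumannAlgebra.exists_mem_of_isClosed_graph`).

Conversely, the four equations and `C D = 1` make `(A₁, B₁)` a right multiple of `(A₂, B₂)` and
vice versa (`eq_mul_of_central_decomposition`), so the two quotients have the same graph.
-/

/-! ### Elements of a von Neumann algebra from their graphs and ranges -/

open ContinuousLinearMap in
/-- A closed, everywhere defined, single-valued linear relation that is invariant under the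
commutant is the graph of an element of the algebra: it is the graph of a bounded operator by the
closed graph theorem, and uniqueness of values makes this operator commute with the commutant. -/
theorem VonNeumannAlgebra.exists_mem_of_isClosed_graph {H : Type*} [NormedAddCommGroup H]
    [InnerProductSpace ℂ H] [CompleteSpace H] (M : VonNeumannAlgebra H)
    (R : Submodule ℂ (H × H)) (hR : IsClosed (R : Set (H × H)))
    (hex : ∀ x, ∃ y, (x, y) ∈ R) (huniq : ∀ y, (0, y) ∈ R → y = 0)
    (hinv : ∀ T ∈ M.commutant, ∀ p ∈ R, (T p.1, T p.2) ∈ R) :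
    ∃ T ∈ M, ∀ x, (x, T x) ∈ R := by
  have huniq' : ∀ x y z, (x, y) ∈ R → (x, z) ∈ R → y = z := fun x y z hy hz =>
    sub_eq_zero.1 (huniq _ (by simpa using R.sub_mem hy hz))
  choose f hf using hex
  let g : H →ₗ[ℂ] H :=
    { toFun := f
      map_add' := fun x y => huniq' _ _ _ (hf _) (by simpa using R.add_mem (hf x) (hf y))
      map_smul' := fun c x => huniq' _ _ _ (hf _) (by simpa using R.smul_mem c (hf x)) }
  have hg : (g.graph : Set (H × H)) = R := by
    ext ⟨x, y⟩
    simp only [SetLike.mem_coe, LinearMap.mem_graph_iff]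
    exact ⟨fun h => by rw [h]; exact hf x, fun h => huniq' _ _ _ h (hf x)⟩
  refine ⟨ofIsClosedGraph (g := g) (hg ▸ hR), ?_, fun x => hf x⟩
  rw [← M.commutant_commutant, VonNeumannAlgebra.mem_commutant_iff]
  intro T hT
  ext x
  exact huniq' _ _ _ (hinv T hT _ (hf x)) (hf (T x))

/-- The orthogonal projection onto a closed subspace invariant under the commutant belongs to
the algebra. The algebra is quantified last so that one projection can be placed in several
algebras, in particular in `M` and in its commutant. -/
theorem VonNeumannAlgebra.exists_isStarProjection_of_isClosed {H : Type*} [NormedAddCommGroup H]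
    [InnerProductSpace ℂ H] [CompleteSpace H]
    (K : Submodule ℂ H) (hK : IsClosed (K : Set H)) :
    ∃ E : H →L[ℂ] H, IsStarProjection E ∧ (∀ y, E y = y ↔ y ∈ K) ∧
      ∀ M : VonNeumannAlgebra H, (∀ T ∈ M.commutant, ∀ y ∈ K, T y ∈ K) → E ∈ M := by
  have : CompleteSpace K := hK.isComplete.completeSpace_coe
  refine ⟨K.starProjection, isStarProjection_starProjection,
    fun y => Submodule.starProjection_eq_self_iff, fun M hM => ?_⟩
  rw [VonNeumannAlgebra.IsStarProjection.mem_iff isStarProjection_starProjection M]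
  intro T hT
  rw [Submodule.range_starProjection, Module.End.mem_invtSubmodule]
  exact fun y hy => hM T hT y hy

theorem VonNeumannAlgebra.apply_comm {H : Type*} [NormedAddCommGroup H]
    [InnerProductSpace ℂ H] [CompleteSpace H] {M : VonNeumannAlgebra H} {A T : H →L[ℂ] H}
    (hA : A ∈ M) (hT : T ∈ M.commutant) (x : H) : A (T x) = T (A x) :=
  congr($(VonNeumannAlgebra.mem_commutant_iff.1 hT A hA) x)

theorem VonNeumannAlgebra.exists_isStarProjection_ker {H : Type*} [NormedAddCommGroup H]
    [InnerProductSpace ℂ H] [CompleteSpace H] (M : VonNeumannAlgebra H) {B : H →L[ℂ] H}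
    (hB : B ∈ M) : ∃ E ∈ M, IsStarProjection E ∧ ∀ y, E y = y ↔ B y = 0 := by
  obtain ⟨E, hE, hEK, hEM⟩ := exists_isStarProjection_of_isClosed
    (LinearMap.ker B.toLinearMap) (B.isClosed_ker)
  refine ⟨E, hEM M fun T hT y hy => ?_, hE, fun y => (hEK y).trans (by simp)⟩
  have hy' : B y = 0 := hy
  change B (T y) = 0
  rw [apply_comm hB hT, hy', map_zero]

/-- **Douglas factorization** in a von Neumann algebra: if `ran A ⊆ ran B`, then `A = B X` for
some `X` in the algebra with range orthogonal to `ker B`. -/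
theorem VonNeumannAlgebra.exists_eq_mul_of_range_le {H : Type*} [NormedAddCommGroup H]
    [InnerProductSpace ℂ H] [CompleteSpace H] (M : VonNeumannAlgebra H) {A B E : H →L[ℂ] H}
    (hA : A ∈ M) (hB : B ∈ M) (hE : IsStarProjection E) (hEM : E ∈ M)
    (hEB : ∀ y, E y = y ↔ B y = 0)
    (h : ∀ x, ∃ y, B y = A x) : ∃ X ∈ M, A = B * X ∧ E * X = 0 := by
  have hEE : ∀ y, E (E y) = E y := fun y => congr($(hE.isIdempotentElem.eq) y)
  let R : Submodule ℂ (H × H) :=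
    { carrier := {p | A p.1 = B p.2 ∧ E p.2 = 0}
      add_mem' := fun {p q} hp hq => by simp [hp.1, hp.2, hq.1, hq.2]
      zero_mem' := by simp
      smul_mem' := fun c p hp => by simp [hp.1, hp.2] }
  have hR : IsClosed (R : Set (H × H)) :=
    (isClosed_eq (by fun_prop) (by fun_prop)).inter (isClosed_eq (by fun_prop) (by fun_prop))
  obtain ⟨X, hX, hXR⟩ := M.exists_mem_of_isClosed_graph R hR
    (fun x => by
      obtain ⟨y, hy⟩ := h x
      refine ⟨y - E y, ?_, ?_⟩
      · change A x = B (y - E y)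
        rw [map_sub, (hEB (E y)).1 (hEE y), sub_zero, hy]
      · change E (y - E y) = 0
        rw [map_sub, hEE, sub_self])
    (fun y hy => by
      have h1 : A 0 = B y := hy.1
      have h2 : E y = 0 := hy.2
      rw [map_zero] at h1
      rw [← (hEB y).2 h1.symm, h2])
    (fun T hT p hp => by
      refine ⟨?_, ?_⟩
      · change A (T p.1) = B (T p.2)
        rw [apply_comm hA hT, apply_comm hB hT, hp.1]
      · change E (T p.2) = 0
        rw [apply_comm hEM hT, hp.2, map_zero])
  exact ⟨X, hX, by ext x; exact (hXR x).1, by ext x; exact (hXR x).2⟩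

/-! ### Equality of quotients -/

theorem quotientOperator_eq_iff {H : Type*} [NormedAddCommGroup H] [InnerProductSpace ℂ H]
    {A₁ B₁ A₂ B₂ : H →L[ℂ] H}
    (h₁ : LinearMap.ker B₁.toLinearMap ≤ LinearMap.ker A₁.toLinearMap)
    (h₂ : LinearMap.ker B₂.toLinearMap ≤ LinearMap.ker A₂.toLinearMap) :
    quotientOperator A₁ B₁ h₁ = quotientOperator A₂ B₂ h₂ ↔
      (∀ x, ∃ y, B₂ y = B₁ x) ∧ (∀ x, ∃ y, B₁ y = B₂ x) ∧
        ∀ x y, B₁ x = B₂ y → A₁ x = A₂ y := by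
  constructor
  · intro h
    have hdom : LinearMap.range B₁.toLinearMap = LinearMap.range B₂.toLinearMap :=
      congrArg LinearPMap.domain h
    refine ⟨fun x => ?_, fun x => ?_, fun x y hxy => ?_⟩
    · have : B₁ x ∈ LinearMap.range B₂.toLinearMap := hdom ▸ ⟨x, rfl⟩
      exact this
    · have : B₂ x ∈ LinearMap.range B₁.toLinearMap := hdom ▸ ⟨x, rfl⟩
      exact this
    · rw [← quotientOperator_apply A₁ B₁ h₁, ← quotientOperator_apply A₂ B₂ h₂]
      exact (LinearPMap.dExt_iff.1 h).2 hxy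
  · rintro ⟨h12, h21, hA⟩
    refine eq_quotientOperator A₂ B₂ h₂ _ ?_ ?_
    · ext z
      exact ⟨by rintro ⟨x, rfl⟩; exact h12 x, by rintro ⟨x, rfl⟩; exact h21 x⟩
    · rintro x ⟨y, hy⟩
      have hy' : B₁ y = B₂ x := hy
      rw [← hA y x hy', ← quotientOperator_apply A₁ B₁ h₁]
      congr 1
      exact Subtype.ext hy'.symm

/-! ### Comparison of projections -/

open scoped InnerProductSpace

/-- A subspace of `H × H` is an *isometric coupling* of the projections `E₁` and `E₂` relative to
`M` if it lies in `ran E₁ × ran E₂`, is invariant under the commutant of `M` acting diagonally,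
and its elements have components of equal norm. Such subspaces are the graphs of the partial
isometries (not necessarily with closed initial space) from `E₁` to `E₂` that commute with
`M.commutant`. -/
structure IsIsometricCoupling {H : Type*} [NormedAddCommGroup H] [InnerProductSpace ℂ H]
    [CompleteSpace H] (M : VonNeumannAlgebra H) (E₁ E₂ : H →L[ℂ] H) (G : Submodule ℂ (H × H)) :
    Prop where
  norm_eq : ∀ p ∈ G, ‖p.1‖ = ‖p.2‖
  left_eq : ∀ p ∈ G, E₁ p.1 = p.1
  right_eq : ∀ p ∈ G, E₂ p.2 = p.2
  invariant : ∀ T ∈ M.commutant, ∀ p ∈ G, (T p.1, T p.2) ∈ G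

namespace IsIsometricCoupling

variable {H : Type*} [NormedAddCommGroup H] [InnerProductSpace ℂ H] [CompleteSpace H]
  {M : VonNeumannAlgebra H} {E₁ E₂ : H →L[ℂ] H} {G : Submodule ℂ (H × H)}

theorem inner_eq (h : IsIsometricCoupling M E₁ E₂ G) {p q : H × H} (hp : p ∈ G) (hq : q ∈ G) :
    ⟪p.1, q.1⟫_ℂ = ⟪p.2, q.2⟫_ℂ := by
  have e1 := h.norm_eq _ (G.add_mem hp hq)
  have e2 := h.norm_eq _ (G.sub_mem hp hq)
  have e3 := h.norm_eq _ (G.add_mem hp (G.smul_mem Complex.I hq))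
  have e4 := h.norm_eq _ (G.sub_mem hp (G.smul_mem Complex.I hq))
  simp only [Prod.fst_add, Prod.snd_add, Prod.fst_sub, Prod.snd_sub, Prod.smul_fst,
    Prod.smul_snd] at e1 e2 e3 e4
  simp only [inner_eq_sum_norm_sq_div_four, RCLike.I_to_complex, e1, e2, e3, e4]

theorem topologicalClosure (h : IsIsometricCoupling M E₁ E₂ G) :
    IsIsometricCoupling M E₁ E₂ G.topologicalClosure where
  norm_eq := fun p hp => by
    have hc : IsClosed {p : H × H | ‖p.1‖ = ‖p.2‖} := isClosed_eq (by fun_prop) (by fun_prop)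
    exact closure_minimal (s := (G : Set (H × H))) h.norm_eq hc hp
  left_eq := fun p hp => by
    have hc : IsClosed {p : H × H | E₁ p.1 = p.1} := isClosed_eq (by fun_prop) (by fun_prop)
    exact closure_minimal (s := (G : Set (H × H))) h.left_eq hc hp
  right_eq := fun p hp => by
    have hc : IsClosed {p : H × H | E₂ p.2 = p.2} := isClosed_eq (by fun_prop) (by fun_prop)
    exact closure_minimal (s := (G : Set (H × H))) h.right_eq hc hp
  invariant := fun T hT p hp => by
    have hf : Continuous fun p : H × H => (T p.1, T p.2) := by fun_prop
    exact map_mem_closure (f := fun p : H × H => (T p.1, T p.2)) hf hp (h.invariant T hT)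

theorem exists_maximal (M : VonNeumannAlgebra H) (E₁ E₂ : H →L[ℂ] H) :
    ∃ G, Maximal (IsIsometricCoupling M E₁ E₂) G := by
  obtain ⟨G, -, hG⟩ := zorn_le_nonempty₀ {G | IsIsometricCoupling M E₁ E₂ G}
    (fun c hc hchain y hy => by
      have hmem : ∀ {p}, p ∈ sSup c ↔ ∃ G ∈ c, p ∈ G :=
        Submodule.mem_sSup_of_directed ⟨y, hy⟩ hchain.directedOn
      refine ⟨sSup c, ⟨fun p hp => ?_, fun p hp => ?_, fun p hp => ?_, fun T hT p hp => ?_⟩,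
        fun z hz => le_sSup hz⟩ <;> obtain ⟨G, hG, hpG⟩ := hmem.1 hp
      · exact (hc hG).norm_eq p hpG
      · exact (hc hG).left_eq p hpG
      · exact (hc hG).right_eq p hpG
      · exact hmem.2 ⟨G, hG, (hc hG).invariant T hT p hpG⟩)
    ⊥ ⟨by simp, by simp, by simp, by simp⟩
  exact ⟨G, hG⟩

theorem isClosed_of_maximal (h : Maximal (IsIsometricCoupling M E₁ E₂) G) :
    IsClosed (G : Set (H × H)) :=
  isClosed_of_closure_subset fun _ hp =>
    h.2 h.1.topologicalClosure G.le_topologicalClosure hp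

/-- The domain of a closed isometric coupling is complete, since the first projection is isometric
on the coupling. -/
theorem isComplete_map_fst (h : IsIsometricCoupling M E₁ E₂ G) (hG : IsClosed (G : Set (H × H))) :
    IsComplete (G.map (LinearMap.fst ℂ H H) : Set H) := by
  let f : G →ₗᵢ[ℂ] H :=
    { toLinearMap := LinearMap.fst ℂ H H ∘ₗ G.subtype
      norm_map' := fun p => by
        change ‖p.1.1‖ = max ‖p.1.1‖ ‖p.1.2‖
        rw [← h.norm_eq _ p.2, max_self] }
  have : CompleteSpace G := hG.isComplete.completeSpace_coe
  have hf : (G.map (LinearMap.fst ℂ H H) : Set H) = Set.range f := by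
    ext x
    simp [f]
  rw [hf]
  exact f.isometry.isClosedEmbedding.isClosed_range.isComplete

/-- A closed isometric coupling is the graph of the restriction of a partial isometry in `M` to
its initial space. The partial isometry is obtained from the relation of all `(x, y)` with
`⟪a, x⟫ = ⟪b, y⟫` for `(a, b) ∈ G` and `y` in the closure of `ran G`. -/
theorem exists_partialIsometry (h : IsIsometricCoupling M E₁ E₂ G)
    (hG : IsClosed (G : Set (H × H))) :
    ∃ V ∈ M, (∀ p ∈ G, V p.1 = p.2) ∧ (∀ p ∈ G, (star V) p.2 = p.1) ∧
      ∀ x, ∃ a, (a, V x) ∈ G := by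
  have hcomplete : CompleteSpace (G.map (LinearMap.fst ℂ H H)) :=
    (h.isComplete_map_fst hG).completeSpace_coe
  let R : Submodule ℂ (H × H) :=
    { carrier := {p | (∀ q ∈ G, ⟪q.1, p.1⟫_ℂ = ⟪q.2, p.2⟫_ℂ) ∧
        p.2 ∈ (G.map (LinearMap.snd ℂ H H))ᗮᗮ}
      add_mem' := fun {p p'} hp hp' => ⟨fun q hq => by
        simp [hp.1 q hq, hp'.1 q hq], Submodule.add_mem _ hp.2 hp'.2⟩
      zero_mem' := ⟨by simp, Submodule.zero_mem _⟩
      smul_mem' := fun c p hp => ⟨fun q hq => by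
        simp [hp.1 q hq], Submodule.smul_mem _ c hp.2⟩ }
  have hmemR : ∀ p : H × H, p ∈ R ↔ (∀ q ∈ G, ⟪q.1, p.1⟫_ℂ = ⟪q.2, p.2⟫_ℂ) ∧
        p.2 ∈ (G.map (LinearMap.snd ℂ H H))ᗮᗮ := fun p => Iff.rfl
  have hRclosed : IsClosed (R : Set (H × H)) := by
    have hcl : IsClosed (⋂ q ∈ G, {p : H × H | ⟪q.1, p.1⟫_ℂ = ⟪q.2, p.2⟫_ℂ}) :=
      isClosed_iInter fun q => isClosed_iInter fun _ => isClosed_eq (by fun_prop) (by fun_prop)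
    convert hcl.inter ((Submodule.isClosed_orthogonal
      (G.map (LinearMap.snd ℂ H H))ᗮ).preimage continuous_snd) using 1
    ext p
    rw [SetLike.mem_coe, hmemR]
    simp only [Set.mem_inter_iff, Set.mem_iInter, Set.mem_preimage, SetLike.mem_coe]
    rfl
  have hGR : ∀ p ∈ G, p ∈ R := fun p hp =>
    ⟨fun q hq => h.inner_eq hq hp, Submodule.le_orthogonal_orthogonal _ ⟨p, hp, rfl⟩⟩
  have huniq : ∀ y, (0, y) ∈ R → y = 0 := fun y hy => by
    have hy' : y ∈ (G.map (LinearMap.snd ℂ H H))ᗮ := by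
      rintro _ ⟨q, hq, rfl⟩
      exact (hy.1 q hq).symm.trans (inner_zero_right _)
    exact (inner_self_eq_zero (𝕜 := ℂ)).1 (hy.2 y hy')
  have hexG : ∀ x, ∃ p ∈ G, (x, p.2) ∈ R := fun x => by
    obtain ⟨p, hp, hpx⟩ := (G.map (LinearMap.fst ℂ H H)).starProjection_apply_mem x
    refine ⟨p, hp, fun q hq => ?_, (hGR p hp).2⟩
    have h0 : ⟪q.1, x - (G.map (LinearMap.fst ℂ H H)).starProjection x⟫_ℂ = 0 :=
      Submodule.sub_starProjection_mem_orthogonal x q.1 ⟨q, hq, rfl⟩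
    rw [← hpx, inner_sub_right, sub_eq_zero] at h0
    exact h0.trans (h.inner_eq hq hp)
  obtain ⟨V, hV, hVR⟩ := M.exists_mem_of_isClosed_graph R hRclosed
    (fun x => (hexG x).imp' Prod.snd fun p hp => hp.2) huniq
    (fun T hT p hp => by
      have hT' : star T ∈ M.commutant := star_mem hT
      refine ⟨fun q hq => ?_, fun z hz => ?_⟩
      · simpa [ContinuousLinearMap.star_eq_adjoint, ContinuousLinearMap.adjoint_inner_left]
          using hp.1 _ (h.invariant _ hT' q hq)
      · have hz' : (star T) z ∈ (G.map (LinearMap.snd ℂ H H))ᗮ := by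
          rintro _ ⟨q, hq, rfl⟩
          simpa [ContinuousLinearMap.star_eq_adjoint, ContinuousLinearMap.adjoint_inner_right]
            using hz (T q.2) ⟨_, h.invariant T hT q hq, rfl⟩
        simpa [ContinuousLinearMap.star_eq_adjoint, ContinuousLinearMap.adjoint_inner_left]
          using hp.2 _ hz')
  have hVeq : ∀ x y, (x, y) ∈ R → V x = y := fun x y hxy =>
    sub_eq_zero.1 (huniq _ (by simpa using R.sub_mem (hVR x) hxy))
  refine ⟨V, hV, fun p hp => hVeq _ _ (hGR p hp), fun p hp => ?_, fun x => ?_⟩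
  · refine ext_inner_right ℂ fun x => ?_
    rw [ContinuousLinearMap.star_eq_adjoint, ContinuousLinearMap.adjoint_inner_left]
    exact ((hVR x).1 p hp).symm
  · obtain ⟨p, hp, hpx⟩ := hexG x
    exact ⟨p.1, by rw [hVeq _ _ hpx]; exact hp⟩

/-- Maximality forbids any element of `M` to map the part of `ran E₁` left over by the coupling
nontrivially into the part of `ran E₂` left over: if `S` were such an element, then the graph of
the partial isometry `|S| x ↦ S x` could be added to the coupling. -/
theorem mul_mul_eq_zero_of_maximal (hE₁ : IsStarProjection E₁) (hE₂ : IsStarProjection E₂)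
    (hE₁M : E₁ ∈ M) (hE₂M : E₂ ∈ M) (h : Maximal (IsIsometricCoupling M E₁ E₂) G)
    {V : H →L[ℂ] H} (hV : V ∈ M) (hVG : ∀ p ∈ G, V p.1 = p.2)
    (hVG' : ∀ p ∈ G, (star V) p.2 = p.1) (hE₂V : E₂ * V = V) (hVE₁ : V * E₁ = V)
    {T : H →L[ℂ] H} (hT : T ∈ M) :
    (E₂ - V * star V) * T * (E₁ - star V * V) = 0 := by
  set F₁ := E₁ - star V * V with hF₁
  set F₂ := E₂ - V * star V with hF₂
  set S := F₂ * T * F₁ with hS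
  have hSM : S ∈ M := mul_mem (mul_mem (sub_mem hE₂M (mul_mem hV (star_mem hV))) hT)
    (sub_mem hE₁M (mul_mem (star_mem hV) hV))
  have hF₂star : star F₂ = F₂ := by simp [hF₂, hE₂.isSelfAdjoint.star_eq]
  have habs : star (CFC.abs S) = CFC.abs S := (CFC.abs_nonneg S).isSelfAdjoint.star_eq
  have habs_inner : ∀ x y, ⟪x, CFC.abs S y⟫_ℂ = ⟪CFC.abs S x, y⟫_ℂ := fun x y => by
    rw [← ContinuousLinearMap.adjoint_inner_left, ← ContinuousLinearMap.star_eq_adjoint, habs]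
  have hnorm : ∀ x, ‖CFC.abs S x‖ = ‖S x‖ := fun x => by
    have e : ⟪CFC.abs S x, CFC.abs S x⟫_ℂ = ⟪S x, S x⟫_ℂ := by
      rw [← habs_inner, ← ContinuousLinearMap.adjoint_inner_right,
        ← ContinuousLinearMap.star_eq_adjoint]
      exact congr(⟪x, $(CFC.abs_mul_abs S) x⟫_ℂ)
    rw [inner_self_eq_norm_sq_to_K, inner_self_eq_norm_sq_to_K] at e
    exact (sq_eq_sq₀ (norm_nonneg _) (norm_nonneg _)).1 (by exact_mod_cast e)
  have hF₂G : ∀ p ∈ G, F₂ p.2 = 0 := fun p hp => by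
    change E₂ p.2 - V ((star V) p.2) = 0
    rw [h.1.right_eq p hp, hVG' p hp, hVG p hp, sub_self]
  have habsG : ∀ p ∈ G, CFC.abs S p.1 = 0 := fun p hp => by
    rw [← norm_eq_zero, hnorm, norm_eq_zero]
    change F₂ (T (E₁ p.1 - (star V) (V p.1))) = 0
    rw [h.1.left_eq p hp, hVG p hp, hVG' p hp, sub_self, map_zero, map_zero]
  have horth : ∀ p ∈ G, ∀ x, ⟪p.2, S x⟫_ℂ = 0 := fun p hp x => by
    change ⟪p.2, F₂ (T (F₁ x))⟫_ℂ = 0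
    rw [← ContinuousLinearMap.adjoint_inner_left, ← ContinuousLinearMap.star_eq_adjoint, hF₂star,
      hF₂G p hp, inner_zero_left]
  have horth' : ∀ p ∈ G, ∀ x, ⟪p.1, CFC.abs S x⟫_ℂ = 0 := fun p hp x => by
    rw [habs_inner, habsG p hp, inner_zero_left]
  have hE₂S : E₂ * S = S := by
    have : E₂ * F₂ = F₂ := by
      rw [hF₂, mul_sub, hE₂.isIdempotentElem.eq, ← mul_assoc, hE₂V]
    rw [hS, ← mul_assoc, ← mul_assoc, this]
  have hSE₁ : S * E₁ = S := by
    have : F₁ * E₁ = F₁ := by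
      rw [hF₁, sub_mul, hE₁.isIdempotentElem.eq, mul_assoc, hVE₁]
    rw [hS, mul_assoc, this]
  have habsE₁ : CFC.abs S * E₁ = CFC.abs S := by
    ext x
    rw [← sub_eq_zero, ← norm_eq_zero]
    change ‖CFC.abs S (E₁ x) - CFC.abs S x‖ = 0
    rw [← map_sub, hnorm, map_sub, norm_eq_zero, sub_eq_zero]
    exact congr($hSE₁ x)
  have hE₁abs : E₁ * CFC.abs S = CFC.abs S := by
    simpa [habs, hE₁.isSelfAdjoint.star_eq] using congr(star $habsE₁)
  let G' : Submodule ℂ (H × H) := LinearMap.range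
    ((CFC.abs S).toLinearMap.prod S.toLinearMap)
  have hsup : IsIsometricCoupling M E₁ E₂ (G ⊔ G') := by
    refine ⟨fun p hsum => ?_, fun p hsum => ?_, fun p hsum => ?_, fun U hU p hsum => ?_⟩ <;>
      obtain ⟨p, hp, _, ⟨x, rfl⟩, rfl⟩ := Submodule.mem_sup.1 hsum
    · change ‖p.1 + CFC.abs S x‖ = ‖p.2 + S x‖
      rw [← sq_eq_sq₀ (norm_nonneg _) (norm_nonneg _), sq, sq,
        norm_add_sq_eq_norm_sq_add_norm_sq_of_inner_eq_zero _ _ (horth p hp x),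
        norm_add_sq_eq_norm_sq_add_norm_sq_of_inner_eq_zero _ _ (horth' p hp x),
        h.1.norm_eq p hp, hnorm]
    · change E₁ (p.1 + CFC.abs S x) = p.1 + CFC.abs S x
      rw [map_add, h.1.left_eq p hp]
      exact congr(p.1 + $hE₁abs x)
    · change E₂ (p.2 + S x) = p.2 + S x
      rw [map_add, h.1.right_eq p hp]
      exact congr(p.2 + $hE₂S x)
    · refine Submodule.mem_sup.2 ⟨_, h.1.invariant U hU p hp, _, ⟨U x, rfl⟩, ?_⟩
      have c1 : Commute S U := VonNeumannAlgebra.mem_commutant_iff.1 hU S hSM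
      have c2 : Commute S (star U) :=
        VonNeumannAlgebra.mem_commutant_iff.1 (star_mem hU) S hSM
      have c3 : CFC.abs S * U = U * CFC.abs S := c1.cfcAbs_left c2
      have e1 : CFC.abs S (U x) = U (CFC.abs S x) := congr($c3 x)
      have e2 : S (U x) = U (S x) := congr($(c1.eq) x)
      ext <;> simp [e1, e2]
  ext x
  exact inner_self_eq_zero.1
    (horth _ (h.2 hsup le_sup_left (Submodule.mem_sup_right ⟨x, rfl⟩)) x)

end IsIsometricCoupling

/-- **Comparison theorem** for projections in a von Neumann algebra: there are a partial isometry
`V` from `E₁` to `E₂` and a central projection `P` such that `V` covers all of `E₂` below `P`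
and starts from all of `E₁` below `1 - P`. -/
theorem VonNeumannAlgebra.exists_comparison {H : Type*} [NormedAddCommGroup H]
    [InnerProductSpace ℂ H] [CompleteSpace H] (M : VonNeumannAlgebra H) {E₁ E₂ : H →L[ℂ] H}
    (hE₁ : IsStarProjection E₁) (hE₂ : IsStarProjection E₂) (hE₁M : E₁ ∈ M) (hE₂M : E₂ ∈ M) :
    ∃ V ∈ M, E₂ * V = V ∧ V * E₁ = V ∧ ∃ P, IsStarProjection P ∧ P ∈ M ∧ P ∈ M.commutant ∧
      V * star V * P = E₂ * P ∧ star V * V * (1 - P) = E₁ * (1 - P) := by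
  obtain ⟨G, hG⟩ := IsIsometricCoupling.exists_maximal M E₁ E₂
  obtain ⟨V, hV, hVG, hVG', hran⟩ :=
    hG.1.exists_partialIsometry (IsIsometricCoupling.isClosed_of_maximal hG)
  have hE₂V : E₂ * V = V := by
    ext x
    obtain ⟨a, ha⟩ := hran x
    exact hG.1.right_eq _ ha
  have hVVV : V * star V * V = V := by
    ext x
    obtain ⟨a, ha⟩ := hran x
    change V ((star V) (V x)) = V x
    rw [hVG' _ ha, hVG _ ha]
  have hVVV' : star V * V * star V = star V := by
    simpa [mul_assoc] using congr(star $hVVV)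
  have hE₁V : E₁ * star V = star V := by
    ext y
    obtain ⟨a, ha⟩ := hran (star V y)
    have e : (star V) y = a := congr($hVVV'.symm y).trans (hVG' _ ha)
    change E₁ ((star V) y) = (star V) y
    rw [e]
    exact hG.1.left_eq _ ha
  have hVE₁ : V * E₁ = V := by
    simpa [hE₁.isSelfAdjoint.star_eq] using congr(star $hE₁V)
  set F₁ := E₁ - star V * V with hF₁
  set F₂ := E₂ - V * star V with hF₂
  have hF₁star : star F₁ = F₁ := by simp [hF₁, hE₁.isSelfAdjoint.star_eq]
  have hF₂star : star F₂ = F₂ := by simp [hF₂, hE₂.isSelfAdjoint.star_eq]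
  have hF₁M : F₁ ∈ M := sub_mem hE₁M (mul_mem (star_mem hV) hV)
  have hzero : ∀ T ∈ M, F₁ * T * F₂ = 0 := fun T hT => by
    have := IsIsometricCoupling.mul_mul_eq_zero_of_maximal hE₁ hE₂ hE₁M hE₂M hG hV hVG hVG'
      hE₂V hVE₁ (star_mem hT)
    simpa [← hF₁, ← hF₂, hF₁star, hF₂star, mul_assoc] using congr(star $this)
  -- `K` is the orthogonal complement of the range of the central support of `F₁`.
  let K : Submodule ℂ H := ⨅ T ∈ M, LinearMap.ker (F₁ * T).toLinearMap
  have hK : ∀ {y}, y ∈ K ↔ ∀ T ∈ M, F₁ (T y) = 0 := by simp [K]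
  have hKclosed : IsClosed (K : Set H) := by
    simp only [K, Submodule.coe_iInf]
    exact isClosed_iInter fun T => isClosed_iInter fun _ => (F₁ * T).isClosed_ker
  obtain ⟨Q, hQ, hQK, hQM⟩ := exists_isStarProjection_of_isClosed K hKclosed
  have hQ1 : Q ∈ M := hQM M fun T hT y hy => hK.2 fun U hU => by
    rw [apply_comm hU hT, apply_comm hF₁M hT, hK.1 hy U hU, map_zero]
  have hQ2 : Q ∈ M.commutant := hQM M.commutant fun T hT y hy => hK.2 fun U hU => by
    rw [M.commutant_commutant] at hT
    exact hK.1 hy (U * T) (mul_mem hU hT)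
  have hF₁Q : F₁ * Q = 0 := by
    ext x
    exact hK.1 ((hQK (Q x)).1 congr($(hQ.isIdempotentElem.eq) x)) 1 (one_mem M)
  have hQF₂ : Q * F₂ = F₂ := by
    ext x
    exact (hQK (F₂ x)).2 (hK.2 fun T hT => congr($(hzero T hT) x))
  have hF₂Q : F₂ * Q = F₂ := by
    simpa [hF₂star, hQ.isSelfAdjoint.star_eq] using congr(star $hQF₂)
  refine ⟨V, hV, hE₂V, hVE₁, 1 - Q, hQ.one_sub, sub_mem (one_mem M) hQ1,
    sub_mem (one_mem _) hQ2, ?_, ?_⟩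
  · rw [eq_comm, ← sub_eq_zero, ← sub_mul, ← hF₂, mul_sub, hF₂Q, mul_one, sub_self]
  · rw [sub_sub_cancel, eq_comm, ← sub_eq_zero, ← sub_mul, ← hF₁, hF₁Q]

/-! ### Algebra of the factors -/

theorem ContinuousLinearMap.mul_eq_self_of_mul_eq_zero {H : Type*} [NormedAddCommGroup H]
    [NormedSpace ℂ H] {B E T : H →L[ℂ] H} (hEB : ∀ y, E y = y ↔ B y = 0) (hT : B * T = 0) :
    E * T = T := by
  ext x
  exact (hEB (T x)).2 congr($hT x)

/-- If `B X Y = B` and `E X = 0` for an idempotent `E` with range `ker B`, then `X Y` is the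
complementary idempotent. -/
theorem ContinuousLinearMap.mul_eq_one_sub_of_mul_mul_eq {H : Type*} [NormedAddCommGroup H]
    [NormedSpace ℂ H] {B E X Y : H →L[ℂ] H} (hEB : ∀ y, E y = y ↔ B y = 0) (hEX : E * X = 0)
    (hB : B * X * Y = B) : X * Y = 1 - E := by
  have h := mul_eq_self_of_mul_eq_zero (T := X * Y - 1) hEB (by
    rw [mul_sub, ← mul_assoc, hB, mul_one, sub_self])
  rw [mul_sub, ← mul_assoc, hEX, zero_mul, zero_sub, mul_one] at h
  rw [sub_eq_add_neg, h, add_sub_cancel]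

/-- Two elements `a`, `b` with `a b P = P` and `b a (1 - P) = 1 - P` for a central idempotent `P`
glue to a right-invertible element. -/
theorem glue_mul_glue_eq_one {R : Type*} [Ring R] {a b P : R} (hP : IsIdempotentElem P)
    (ha : a * P = P * a) (hb : b * P = P * b) (hab : a * b * P = P)
    (hba : b * a * (1 - P) = 1 - P) :
    (a * P + b * (1 - P)) * (b * P + a * (1 - P)) = 1 := by
  have hP0 : P * (1 - P) = 0 := hP.mul_one_sub_self
  have hP0' : (1 - P) * P = 0 := hP.one_sub_mul_self
  have ha' : a * (1 - P) = (1 - P) * a := by rw [mul_sub, sub_mul, ha, mul_one, one_mul]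
  have h1 : a * P * (b * P) = P := by
    rw [mul_assoc, ← mul_assoc P b, ← hb, mul_assoc b, hP.eq, ← mul_assoc, hab]
  have h2 : a * P * (a * (1 - P)) = 0 := by
    rw [ha', mul_assoc, ← mul_assoc P, hP0, zero_mul, mul_zero]
  have h3 : b * (1 - P) * (b * P) = 0 := by
    rw [hb, mul_assoc, ← mul_assoc (1 - P), hP0', zero_mul, mul_zero]
  have h4 : b * (1 - P) * (a * (1 - P)) = 1 - P := by
    rw [mul_assoc, ← mul_assoc (1 - P) a, ← ha', mul_assoc a, hP.one_sub.eq, ← mul_assoc, hba]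
  rw [add_mul, mul_add, mul_add, h1, h2, h3, h4, add_zero, zero_add, add_sub_cancel]

/-- If `A₁ P = A₂ C P` and `A₂ Q = A₁ C Q` with `C D = 1`, `P + Q = 1` and `Q`
commuting with `D`, then `A₁` is a right multiple of `A₂`, by a factor that depends only on
`C`, `D`, `P`, `Q`. -/
theorem eq_mul_of_central_decomposition {R : Type*} [Ring R] {A₁ A₂ C D P Q : R} (hCD : C * D = 1)
    (hPQ : P + Q = 1) (hDQ : D * Q = Q * D)
    (h₁ : A₁ * P = A₂ * C * P) (h₂ : A₂ * Q = A₁ * C * Q) :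
    A₁ = A₂ * (C * P + Q * D) :=
  calc A₁ = A₁ * P + A₁ * (C * D) * Q := by
        rw [hCD, mul_one, ← mul_add, hPQ, mul_one]
    _ = A₁ * P + A₁ * C * Q * D := by simp only [mul_assoc, hDQ]
    _ = A₂ * (C * P + Q * D) := by rw [h₁, ← h₂]; noncomm_ring

/-! ### Uniqueness of the representation as a quotient -/

theorem mainTheorem5 {H : Type*} [NormedAddCommGroup H] [InnerProductSpace ℂ H] [CompleteSpace H]
    (M : VonNeumannAlgebra H) (A₁ B₁ A₂ B₂ : H →L[ℂ] H)
    (hA₁ : A₁ ∈ M) (hB₁ : B₁ ∈ M) (hA₂ : A₂ ∈ M) (hB₂ : B₂ ∈ M)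
    (h₁ : LinearMap.ker B₁.toLinearMap ≤ LinearMap.ker A₁.toLinearMap)
    (h₂ : LinearMap.ker B₂.toLinearMap ≤ LinearMap.ker A₂.toLinearMap) :
    quotientOperator A₁ B₁ h₁ = quotientOperator A₂ B₂ h₂ ↔
      ∃ C ∈ M, (∃ D ∈ M, C * D = 1) ∧
        ∃ P Q : H →L[ℂ] H,
          (P ∈ M ∧ P ∈ M.commutant ∧ IsStarProjection P) ∧
          (Q ∈ M ∧ Q ∈ M.commutant ∧ IsStarProjection Q) ∧
          P + Q = 1 ∧
          A₁ * P = A₂ * C * P ∧ B₁ * P = B₂ * C * P ∧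
          A₂ * Q = A₁ * C * Q ∧ B₂ * Q = B₁ * C * Q := by
  rw [quotientOperator_eq_iff]
  constructor
  · rintro ⟨h12, h21, hA⟩
    obtain ⟨E₁, hE₁M, hE₁, hE₁B⟩ := M.exists_isStarProjection_ker hB₁
    obtain ⟨E₂, hE₂M, hE₂, hE₂B⟩ := M.exists_isStarProjection_ker hB₂
    obtain ⟨X, hX, hB₁X, hE₂X⟩ := M.exists_eq_mul_of_range_le hB₁ hB₂ hE₂ hE₂M hE₂B h12
    obtain ⟨Y, hY, hB₂Y, hE₁Y⟩ := M.exists_eq_mul_of_range_le hB₂ hB₁ hE₁ hE₁M hE₁B h21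
    obtain ⟨V, hV, hE₂V, hVE₁, P, hP, hPM, hPM', hVP, hVQ⟩ :=
      M.exists_comparison hE₁ hE₂ hE₁M hE₂M
    -- `X` and `Y` are inverse to each other between the orthogonal complements of the kernels,
    -- and vanish on the kernels.
    -- `X` and `Y` are inverse to each other between the orthogonal complements of the kernels,
    -- and vanish on the kernels.
    have hXY : X * Y = 1 - E₂ :=
      ContinuousLinearMap.mul_eq_one_sub_of_mul_mul_eq hE₂B hE₂X (by rw [← hB₁X, ← hB₂Y])
    have hYX : Y * X = 1 - E₁ :=
      ContinuousLinearMap.mul_eq_one_sub_of_mul_mul_eq hE₁B hE₁Y (by rw [← hB₂Y, ← hB₁X])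
    have hBE₁ : B₁ * E₁ = 0 := by
      ext x
      exact (hE₁B _).1 congr($(hE₁.isIdempotentElem.eq) x)
    have hBE₂ : B₂ * E₂ = 0 := by
      ext x
      exact (hE₂B _).1 congr($(hE₂.isIdempotentElem.eq) x)
    have hXE₁ : X * E₁ = 0 := by
      rw [← ContinuousLinearMap.mul_eq_self_of_mul_eq_zero (T := X * E₁) hE₂B
        (by rw [← mul_assoc, ← hB₁X, hBE₁]), ← mul_assoc, hE₂X, zero_mul]
    have hYE₂ : Y * E₂ = 0 := by
      rw [← ContinuousLinearMap.mul_eq_self_of_mul_eq_zero (T := Y * E₂) hE₁B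
        (by rw [← mul_assoc, ← hB₂Y, hBE₂]), ← mul_assoc, hE₁Y, zero_mul]
    have hE₁V : E₁ * star V = star V := by
      simpa [hE₁.isSelfAdjoint.star_eq] using congr(star $hVE₁)
    have hXV : X * star V = 0 := by rw [← hE₁V, ← mul_assoc, hXE₁, zero_mul]
    have hVY : V * Y = 0 := by rw [← hVE₁, mul_assoc, hE₁Y, mul_zero]
    have hYV : Y * V = 0 := by rw [← hE₂V, ← mul_assoc, hYE₂, zero_mul]
    have hVX : star V * X = 0 := by
      have hVE₂ : star V * E₂ = star V := by
        simpa [hE₂.isSelfAdjoint.star_eq] using congr(star $hE₂V)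
      rw [← hVE₂, mul_assoc, hE₂X, mul_zero]
    have hA₁X : A₁ = A₂ * X := by
      ext x
      exact hA x (X x) congr($hB₁X x)
    have hA₂Y : A₂ = A₁ * Y := by
      ext x
      exact (hA (Y x) x congr($hB₂Y.symm x)).symm
    have hAV : A₂ * V = 0 := by
      ext x
      exact h₂ (show B₂ (V x) = 0 by rw [← hE₂B]; exact congr($hE₂V x))
    have hBV : B₂ * V = 0 := by rw [← hE₂V, ← mul_assoc, hBE₂, zero_mul]
    have hAV' : A₁ * star V = 0 := by
      ext x
      exact h₁ (show B₁ ((star V) x) = 0 by rw [← hE₁B]; exact congr($hE₁V x))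
    have hBV' : B₁ * star V = 0 := by rw [← hE₁V, ← mul_assoc, hBE₁, zero_mul]
    have haM : X + V ∈ M := add_mem hX hV
    have hbM : Y + star V ∈ M := add_mem hY (star_mem hV)
    have hQM : 1 - P ∈ M := sub_mem (one_mem M) hPM
    have hglue := glue_mul_glue_eq_one hP.isIdempotentElem
      (VonNeumannAlgebra.mem_commutant_iff.1 hPM' _ haM)
      (VonNeumannAlgebra.mem_commutant_iff.1 hPM' _ hbM)
      (by rw [add_mul, mul_add, mul_add, hXY, hXV, hVY, add_zero, zero_add, add_mul, hVP]
          noncomm_ring)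
      (by rw [add_mul, mul_add, mul_add, hYX, hYV, hVX, add_zero, zero_add, add_mul, hVQ]
          noncomm_ring)
    have hP0 : (1 - P) * P = 0 := hP.isIdempotentElem.one_sub_mul_self
    have hP0' : P * (1 - P) = 0 := hP.isIdempotentElem.mul_one_sub_self
    have hCP : ((X + V) * P + (Y + star V) * (1 - P)) * P = (X + V) * P := by
      rw [add_mul, mul_assoc, mul_assoc, hP0, hP.isIdempotentElem.eq, mul_zero, add_zero]
    have hCQ : ((X + V) * P + (Y + star V) * (1 - P)) * (1 - P) = (Y + star V) * (1 - P) := by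
      rw [add_mul, mul_assoc, mul_assoc, hP0', hP.one_sub.isIdempotentElem.eq, mul_zero, zero_add]
    refine ⟨(X + V) * P + (Y + star V) * (1 - P), add_mem (mul_mem haM hPM) (mul_mem hbM hQM),
      ⟨(Y + star V) * P + (X + V) * (1 - P), add_mem (mul_mem hbM hPM) (mul_mem haM hQM), hglue⟩,
      P, 1 - P, ⟨hPM, hPM', hP⟩, ⟨hQM, sub_mem (one_mem _) hPM', hP.one_sub⟩,
      add_sub_cancel _ _, ?_, ?_, ?_, ?_⟩
    · rw [mul_assoc A₂, hCP, ← mul_assoc, mul_add, hAV, add_zero, ← hA₁X]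
    · rw [mul_assoc B₂, hCP, ← mul_assoc, mul_add, hBV, add_zero, ← hB₁X]
    · rw [mul_assoc A₁, hCQ, ← mul_assoc, mul_add, hAV', add_zero, ← hA₂Y]
    · rw [mul_assoc B₁, hCQ, ← mul_assoc, mul_add, hBV', add_zero, ← hB₂Y]
  · rintro ⟨C, hC, ⟨D, hD, hCD⟩, P, Q, ⟨hPM, hPM', hP⟩, ⟨hQM, hQM', hQ⟩, hPQ, a1, b1, a2, b2⟩
    have hDP : D * P = P * D := VonNeumannAlgebra.mem_commutant_iff.1 hPM' D hD
    have hDQ : D * Q = Q * D := VonNeumannAlgebra.mem_commutant_iff.1 hQM' D hD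
    have hQP : Q + P = 1 := (add_comm Q P).trans hPQ
    have eA := eq_mul_of_central_decomposition hCD hPQ hDQ a1 a2
    have eB := eq_mul_of_central_decomposition hCD hPQ hDQ b1 b2
    have eB' := eq_mul_of_central_decomposition hCD hQP hDP b2 b1
    refine ⟨fun x => ⟨_, congr($eB.symm x)⟩, fun x => ⟨_, congr($eB'.symm x)⟩, fun x y hxy => ?_⟩
    have e1 : B₂ ((C * P + Q * D) x - y) = 0 := by
      rw [map_sub, ← hxy, sub_eq_zero]
      exact congr($eB.symm x)
    have e2 : A₂ ((C * P + Q * D) x - y) = 0 := h₂ e1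
    rw [map_sub, sub_eq_zero] at e2
    rw [← e2]
    exact congr($eA x)
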